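/- Let $Q$ be a smooth finite-dimensional manifold without boundary. A \emph{discretization map} on a manifold $M$ is a smooth map $R=(R^1,R^2)\colon U\subset TM\to M\times M$, where $U$ is an open neighbourhood of the zero section of $TM$, such that $R(x,0)=(x,x)$ and $T_{0_x}R^2_x-T_{0_x}R^1_x=\mathrm{Id}_{T_xM}$ for all $x\in M$, where $R^a_x$ is the restriction of $R^a$ to $T_xM$ and $T_{0_x}T_xM\simeq T_xM$. For any map $R\colon U\subset TM\to M\times M$, its \emph{adjoint} is the map $R^*(x,v)=I_M(R(x,-v))$ with $I_M(x,y)=(y,x)$, defined on $\{(x,v)\in TM : (x,-v)\in U\}$; $R$ is \emph{symmetric} if $R^*=R$ (equality of partially defined maps: same domain and same values). Let $R_d\colon U\subset TQ\to Q\times Q$ be a discretization map on $Q$. For $\beta\in T^*_wTQ$ with $w\in U$ and $T_wR_d$ invertible put $\widehat{R_d}(\beta)=\beta\circ(T_wR_d)^{-1}\in T^*_{R_d(w)}(Q\times Q)$. Let $\alpha_Q\colon TT^*Q\to T^*TQ$ be the canonical isomorphism, locally $(q,p,\dot q,\dot p)\mapsto(q,\dot q,\dot p,p)$, and let $\Phi\colon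 T^*Q\times T^*Q\to T^*(Q\times Q)$, $(q_0,p_0;q_1,p_1)\mapsto(q_0,q_1,-p_0,p_1)$. The \emph{cotangent lift} of $R_d$ is the map $$R_d^{T^*}=\Phi^{-1}\circ\widehat{R_d}\circ\alpha_Q\colon TT^*Q\to T^*Q\times T^*Q ,$$ defined at those $V\in TT^*Q$ for which $\alpha_Q(V)$ lies over a point $w\in U$ at which $T_wR_d$ is invertible. The cotangent lift of $R_d^*$ is defined in the same way. Then taking the cotangent lift commutes with taking the adjoint, $$(R_d^*)^{T^*}=(R_d^{T^*})^* ,$$ as an equality of partially defined maps $TT^*Q\to T^*Q\times T^*Q$. In particular, if $R_d$ is symmetric, then its cotangent lift $R_d^{T^*}$ is symmetric. -/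

import Mathlib

open scoped Manifold ContDiff

noncomputable section

namespace DiscretizationMaps

section Defs

variable {E : Type*} [NormedAddCommGroup E] [NormedSpace ℝ E]
  {H : Type*} [TopologicalSpace H] (I : ModelWithCorners ℝ E H)
  (M : Type*) [TopologicalSpace M] [ChartedSpace H M]

/-! ### Partial maps, discretization maps, adjoints -/

/-- A map `R : U ⊆ TM → M × M` defined on a subset `U = dom` of the tangent bundle. Only the values
of `toFun` on `dom` are meaningful. -/
structure PartialMap where
  dom : Set (TangentBundle I M)
  toFun : TangentBundle I M → M × M

variable {I M}

namespace PartialMap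

/-- Equality of partial maps: the same domain, and the same values on it. -/
def Same (R S : PartialMap I M) : Prop :=
  R.dom = S.dom ∧ Set.EqOn R.toFun S.toFun R.dom

end PartialMap

/-- The fibrewise reflection `(x, v) ↦ (x, -v)` of the tangent bundle. -/
def fiberNeg (w : TangentBundle I M) : TangentBundle I M := ⟨w.proj, -w.snd⟩

namespace PartialMap

/-- The adjoint `R^*(x, v) = I_M (R (x, -v))` with `I_M (x, y) = (y, x)`, defined on
`{(x, v) | (x, -v) ∈ U}`. -/
def adjoint (R : PartialMap I M) : PartialMap I M where
  dom := {w | fiberNeg w ∈ R.dom}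
  toFun w := (R.toFun (fiberNeg w)).swap

/-- `R` is symmetric if it is equal to its adjoint. -/
def IsSymmetric (R : PartialMap I M) : Prop := R.adjoint.Same R

/-- `R = (R¹, R²) : U ⊆ TM → M × M` is a discretization map on `M`. -/
structure IsDiscretizationMap [IsManifold I ∞ M] (R : PartialMap I M) : Prop where
  /-- The domain is an open neighbourhood of the zero section. -/
  isOpen_dom : IsOpen R.dom
  zero_mem_dom : ∀ x : M, (⟨x, 0⟩ : TangentBundle I M) ∈ R.dom
  /-- The map is smooth. -/
  smooth : ContMDiffOn I.tangent (I.prod I) ∞ R.toFun R.dom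
  /-- `R (x, 0) = (x, x)`. -/
  map_zero : ∀ x : M, R.toFun ⟨x, 0⟩ = (x, x)
  /-- `T_{0_x} R²_x - T_{0_x} R¹_x = Id` on `T_x M`, where `R^a_x = R^a|_{T_x M}`. Both derivatives
  take values in `T_x M` by the preceding condition; all these tangent spaces are the model space
  `E` (by means of the preferred chart at `x`). -/
  deriv_zero : ∀ x : M,
    let D₁ : E →L[ℝ] E := mfderiv 𝓘(ℝ, E) I (fun u : E => (R.toFun ⟨x, u⟩).1) 0
    let D₂ : E →L[ℝ] E := mfderiv 𝓘(ℝ, E) I (fun u : E => (R.toFun ⟨x, u⟩).2) 0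
    D₂ - D₁ = ContinuousLinearMap.id ℝ E

end PartialMap

/-! ### The cotangent bundle -/

variable (I) in
/-- The cotangent space `T_x^* M`, the dual of the tangent space. -/
abbrev CotangentSpace (x : M) : Type _ := TangentSpace I x →L[ℝ] Bundle.Trivial M ℝ x

variable (I M) in
/-- The cotangent bundle `T^*M`. It is a vector bundle over `M` with fibre `E →L[ℝ] ℝ`, and its
total space is a manifold modelled on `E × (E →L[ℝ] ℝ)`, by Mathlib's instances for bundles of
continuous linear maps. -/
abbrev CotangentBundle : Type _ :=
  Bundle.TotalSpace (E →L[ℝ] ℝ) (fun x : M => CotangentSpace I x)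

variable (I) in
/-- The model with corners of the manifold `T^*M`. -/
abbrev cotangentModel : ModelWithCorners ℝ (E × (E →L[ℝ] ℝ)) (ModelProd H (E →L[ℝ] ℝ)) :=
  I.prod 𝓘(ℝ, E →L[ℝ] ℝ)

variable {E' : Type*} [NormedAddCommGroup E'] [NormedSpace ℝ E']
  {H' : Type*} [TopologicalSpace H'] {I' : ModelWithCorners ℝ E' H'}
  {M' : Type*} [TopologicalSpace M'] [ChartedSpace H' M']

variable (I I') in
/-- The cotangent lift `F̂ = T^* F⁻¹ : T^*M → T^*M'`, `F̂ (β_x) = β_x ∘ (T_x F)⁻¹ ∈ T^*_{F x} M'`.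
It is meaningful at the points `x` at which `F` is a local diffeomorphism, that is, at which
`T_x F` is invertible; there `(T_x F)⁻¹` is the tangent map at `F x` of a local inverse of `F`. -/
def hatLift (F : M → M') (β : CotangentBundle I M) : CotangentBundle I' M' :=
  ⟨F β.proj, ContinuousLinearMap.comp (β.snd : TangentSpace I β.proj →L[ℝ] ℝ)
    (mfderiv I I' F β.proj).inverse⟩

variable (I M) in
/-- The diffeomorphism `Φ : T^*M × T^*M → T^*(M × M)`, `(q₀, p₀; q₁, p₁) ↦ (q₀, q₁, -p₀, p₁)`. -/
def Phi : CotangentBundle I M × CotangentBundle I M ≃ CotangentBundle (I.prod I) (M × M) where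
  toFun a := ⟨(a.1.proj, a.2.proj),
    ContinuousLinearMap.coprod (M₁ := TangentSpace I a.1.proj) (M₂ := TangentSpace I a.2.proj)
      (-(a.1.snd : TangentSpace I a.1.proj →L[ℝ] ℝ))
      (a.2.snd : TangentSpace I a.2.proj →L[ℝ] ℝ)⟩
  invFun b :=
    (⟨b.proj.1, -(ContinuousLinearMap.comp (b.snd : E × E →L[ℝ] ℝ)
        (ContinuousLinearMap.inl ℝ E E))⟩,
      ⟨b.proj.2, ContinuousLinearMap.comp (b.snd : E × E →L[ℝ] ℝ)
        (ContinuousLinearMap.inr ℝ E E)⟩)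
  left_inv a := by
    obtain ⟨⟨x, p⟩, ⟨y, r⟩⟩ := a
    have h1 : ∀ p r : E →L[ℝ] ℝ,
        -((ContinuousLinearMap.coprod (-p) r).comp (ContinuousLinearMap.inl ℝ E E)) = p := by
      intro p r; ext u; simp
    have h2 : ∀ p r : E →L[ℝ] ℝ,
        (ContinuousLinearMap.coprod (-p) r).comp (ContinuousLinearMap.inr ℝ E E) = r := by
      intro p r; ext u; simp
    exact Prod.ext (congrArg (Bundle.TotalSpace.mk x) (h1 p r))
      (congrArg (Bundle.TotalSpace.mk y) (h2 p r))
  right_inv b := by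
    obtain ⟨⟨x, y⟩, β⟩ := b
    have h : ∀ β : E × E →L[ℝ] ℝ,
        ContinuousLinearMap.coprod (-(-(β.comp (ContinuousLinearMap.inl ℝ E E))))
          (β.comp (ContinuousLinearMap.inr ℝ E E)) = β := by
      intro β; ext u <;> simp
    exact congrArg (Bundle.TotalSpace.mk (x, y)) (h β)

/-! ### The canonical isomorphism `α_M : TT^*M → T^*TM` -/

open Bundle in
/-- The velocity at `0` of a curve in the total space of a bundle `Z` over `M`: its components are
the derivatives of the two components of the curve in the preferred chart at its starting point. -/
lemma hasDerivAt_total {F : Type*} [NormedAddCommGroup F] [NormedSpace ℝ F] {Z : M → Type*}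
    [TopologicalSpace (Bundle.TotalSpace F Z)] [∀ x, TopologicalSpace (Z x)] [FiberBundle F Z]
    (f : ℝ → Bundle.TotalSpace F Z) (hf : MDifferentiableAt 𝓘(ℝ, ℝ) (I.prod 𝓘(ℝ, F)) f 0) :
    HasDerivAt (fun t => extChartAt I (f 0).proj (f t).proj)
      (mfderiv 𝓘(ℝ, ℝ) (I.prod 𝓘(ℝ, F)) f 0 (1 : ℝ) : E × F).1 0 ∧
    HasDerivAt (fun t => (trivializationAt F Z (f 0).proj (f t)).2)
      (mfderiv 𝓘(ℝ, ℝ) (I.prod 𝓘(ℝ, F)) f 0 (1 : ℝ) : E × F).2 0 := by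
  have h := hf.hasMFDerivAt.2
  simp only [writtenInExtChartAt, modelWithCornersSelf_coe, Set.range_id,
    extChartAt_model_space_eq_id] at h
  rw [FiberBundle.extChartAt] at h
  have h2 : HasFDerivAt (fun t : ℝ => ((extChartAt I (f 0).proj (f t).proj, (trivializationAt F Z (f 0).proj (f t)).2) : E × F))
    (mfderiv 𝓘(ℝ, ℝ) (I.prod 𝓘(ℝ, F)) f 0 : ℝ →L[ℝ] E × F) (0:ℝ) := by
    have h3 := (hasFDerivWithinAt_univ.1 h)
    refine h3.congr_of_eventuallyEq ?_
    have : ∀ᶠ t in nhds (0:ℝ), f t ∈ (trivializationAt F Z (f 0).proj).source :=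
      hf.continuousAt.eventually ((trivializationAt F Z (f 0).proj).open_source.mem_nhds (by simp))
    filter_upwards [this] with t ht
    simp [Trivialization.coe_fst _ ht]
  exact ⟨h2.fst.hasDerivAt, h2.snd.hasDerivAt⟩

variable [IsManifold I ∞ M]

/-- The canonical (Tulczyjew) isomorphism `α_M : TT^*M → T^*TM`, given in the coordinates induced
by a chart of `M` by `(q, p, q̇, ṗ) ↦ (q, q̇, ṗ, p)`. For `q = π (V)`, the tangent spaces
`T_{(q, p)} T^*M = E × (E →L[ℝ] ℝ)` and `T_{(q, q̇)} TM = E × E` are by construction the spaces of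
vectors in the coordinates induced by the preferred chart of `M` at `q`. -/
def tulczyjew (V : TangentBundle (cotangentModel I) (CotangentBundle I M)) :
    CotangentBundle I.tangent (TangentBundle I M) :=
  let p : E →L[ℝ] ℝ := V.proj.snd
  let V' : E × (E →L[ℝ] ℝ) := V.snd
  ⟨⟨V.proj.proj, V'.1⟩, ContinuousLinearMap.coprod (M₁ := E) (M₂ := E) V'.2 p⟩

open Bundle in
/-- Validation of the definition of `tulczyjew`: it satisfies the intrinsic characterization of
`α_M`. If `σ = (c, p)` is a curve in `T^*M` and `γ = (c, v)` a curve in `TM` over the same base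
curve `c`, with velocities `σ'` and `γ'` at `0`, then `α_M (σ')` lies over `ċ(0)`, and
`⟨α_M (σ'), κ_M (γ')⟩ = d/dt ⟨p (t), v (t)⟩` at `t = 0`, where `κ_M (γ') = (v 0, γ'.2)` is the image
of `γ' = (ċ(0), γ'.2) ∈ T_{(c 0, v 0)} TM` under the canonical involution
`κ_M (q, v, q̇, v̇) = (q, q̇, v, v̇)`. In particular `tulczyjew` does not depend on charts. -/
theorem tulczyjew_pairing (c : ℝ → M) (p : ∀ t, CotangentSpace I (c t))
    (v : ∀ t, TangentSpace I (c t))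
    (hp : MDifferentiableAt 𝓘(ℝ, ℝ) (cotangentModel I)
      (fun t => (⟨c t, p t⟩ : CotangentBundle I M)) 0)
    (hv : MDifferentiableAt 𝓘(ℝ, ℝ) I.tangent
      (fun t => (⟨c t, v t⟩ : TangentBundle I M)) 0) :
    let σ' : E × (E →L[ℝ] ℝ) := mfderiv 𝓘(ℝ, ℝ) (cotangentModel I)
      (fun t => (⟨c t, p t⟩ : CotangentBundle I M)) 0 (1 : ℝ)
    let γ' : E × E := mfderiv 𝓘(ℝ, ℝ) I.tangent
      (fun t => (⟨c t, v t⟩ : TangentBundle I M)) 0 (1 : ℝ)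
    let α := tulczyjew (⟨⟨c 0, p 0⟩, σ'⟩ : TangentBundle (cotangentModel I) (CotangentBundle I M))
    α.proj = ⟨c 0, γ'.1⟩ ∧ HasDerivAt (fun t => (p t (v t) : ℝ)) (α.snd (v 0, γ'.2)) 0 := by
  intro σ' γ' α
  obtain ⟨h1, h2⟩ := hasDerivAt_total _ hp
  obtain ⟨h3, h4⟩ := hasDerivAt_total _ hv
  refine ⟨?_, ?_⟩
  · exact congrArg (TotalSpace.mk (c 0)) (h1.unique h3)
  · have h5 := h2.clm_apply h4
    have key : ∀ᶠ t in nhds (0:ℝ), c t ∈ (chartAt H (c 0)).source := by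
      have : ContinuousAt c 0 := by
        have := (FiberBundle.continuous_proj E (TangentSpace I : M → Type _)).continuousAt.comp hv.continuousAt
        exact this
      exact this.eventually ((chartAt H (c 0)).open_source.mem_nhds (mem_chart_source H _))
    have hval : ∀ t, c t ∈ (chartAt H (c 0)).source → (trivializationAt (E →L[ℝ] ℝ) (fun x : M => CotangentSpace I x) (c 0) (⟨c t, p t⟩ : CotangentBundle I M)).2 ((trivializationAt E (TangentSpace I : M → Type _) (c 0) (⟨c t, v t⟩ : TangentBundle I M)).2) = p t (v t) := by
      intro t ht
      rw [hom_trivializationAt_apply]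
      rw [ContinuousLinearMap.inCoordinates_eq (by simpa using ht) (by simp)]
      have ht' : c t ∈ (trivializationAt E (TangentSpace I : M → Type _) (c 0)).baseSet := by simpa using ht
      change (p t) (((trivializationAt E (TangentSpace I : M → Type _) (c 0)).continuousLinearEquivAt ℝ (c t) ht').symm ((trivializationAt E (TangentSpace I : M → Type _) (c 0)).continuousLinearEquivAt ℝ (c t) ht' (v t))) = _
      rw [ContinuousLinearEquiv.symm_apply_apply]
    have z := hval 0 (mem_chart_source H _)
    refine (h5.congr_of_eventuallyEq (key.mono fun t ht => (hval t ht).symm)).congr_deriv ?_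
    have e1 : (trivializationAt E (TangentSpace I : M → Type _) (c 0) (⟨c 0, v 0⟩ : TangentBundle I M)).2 = v 0 := by
      rw [TangentBundle.trivializationAt_apply]
      exact tangentCoordChange_self (I := I) (mem_extChartAt_source (c 0))
    have e2 : (trivializationAt (E →L[ℝ] ℝ) (fun x : M => CotangentSpace I x) (c 0) (⟨c 0, p 0⟩ : CotangentBundle I M)).2 = (p 0 : E →L[ℝ] ℝ) := by
      rw [hom_trivializationAt_apply]
      rw [ContinuousLinearMap.inCoordinates_eq (FiberBundle.mem_baseSet_trivializationAt' _) (by simp)]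
      ext w
      change (p 0) (((trivializationAt E (TangentSpace I : M → Type _) (c 0)).continuousLinearEquivAt ℝ (c 0) _).symm w) = p 0 w
      congr 1
      refine (ContinuousLinearEquiv.symm_apply_eq _).2 ?_
      change w = (trivializationAt E (TangentSpace I : M → Type _) (c 0) (⟨c 0, w⟩ : TangentBundle I M)).2
      rw [TangentBundle.trivializationAt_apply]
      exact (tangentCoordChange_self (I := I) (mem_extChartAt_source (c 0))).symm
    erw [e1, e2]
    rfl

/-! ### The cotangent lift of a discretization map -/

/-- The cotangent lift `R^{T^*} = Φ⁻¹ ∘ R̂ ∘ α_M : TT^*M → T^*M × T^*M`, defined at the vectors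
`V` for which `α_M V` lies over a point of the domain of `R` at which `R` is a local
diffeomorphism. -/
def PartialMap.cotangentLift (R : PartialMap I M) :
    PartialMap (cotangentModel I) (CotangentBundle I M) where
  dom := {V | (tulczyjew V).proj ∈ R.dom ∧
    (mfderiv I.tangent (I.prod I) R.toFun (tulczyjew V).proj).IsInvertible}
  toFun V := (Phi I M).symm (hatLift I.tangent (I.prod I) R.toFun (tulczyjew V))

end Defs

end DiscretizationMaps

end

/-!
The adjoint of `R` is `R` conjugated by two diffeomorphisms: the fibrewise reflection
`(x, v) ↦ (x, -v)` of `TM` and the exchange of the factors of `M × M`. In the charts of `TM` the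
reflection is linear, so `T_w R^* = swap ∘ T_{-w} R ∘ ((u, v) ↦ (u, -v))`, and the tangent maps of
`R^*` at `w` and of `R` at `-w` are invertible simultaneously. Under `α_M` the reflection of
`TT^*M` is `(q, q̇, ṗ, p) ↦ (q, -q̇, -ṗ, p)`, whereas the reflected tangent map turns `(ṗ, p)` into
`(ṗ, -p) = -(-ṗ, p)`. The leftover sign is exactly the one produced by exchanging the two factors
across `Φ`, which negates the first momentum only.
-/

namespace DiscretizationMaps

open scoped Topology

section LinearAlgebra

variable {𝕜 : Type*} [Ring 𝕜]
  {E : Type*} [TopologicalSpace E] [AddCommGroup E] [Module 𝕜 E]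
  {F : Type*} [TopologicalSpace F] [AddCommGroup F] [Module 𝕜 F] [ContinuousNeg F]
  {G : Type*} [TopologicalSpace G] [AddCommGroup G] [Module 𝕜 G]
  {G' : Type*} [TopologicalSpace G'] [AddCommGroup G'] [Module 𝕜 G']
  {W : Type*} [TopologicalSpace W] [AddCommGroup W] [Module 𝕜 W] [IsTopologicalAddGroup W]

variable (𝕜 E F) in
/-- The reflection `(u, v) ↦ (u, -v)` of `E × F`, which is the fibrewise reflection `fiberNeg` of a
tangent bundle read in charts. -/
def negSnd : (E × F) ≃L[𝕜] (E × F) :=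
  (ContinuousLinearEquiv.refl 𝕜 E).prodCongr (ContinuousLinearEquiv.neg 𝕜)

@[simp]
lemma negSnd_apply (u : E × F) : negSnd 𝕜 E F u = (u.1, -u.2) := rfl

@[simp]
lemma negSnd_symm : (negSnd 𝕜 E F).symm = negSnd 𝕜 E F := rfl

/-- The linear counterpart `(u, v) ↦ swap (D (u, -v))` of the adjoint of a partial map: the tangent
map of `R.adjoint` at `w` is the linear adjoint of the tangent map of `R` at `fiberNeg w`. -/
def linearAdjoint (D : E × F →L[𝕜] G × G') : E × F →L[𝕜] G' × G :=
  (ContinuousLinearEquiv.prodComm 𝕜 G G' : G × G' →L[𝕜] G' × G) ∘L D ∘L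
    (negSnd 𝕜 E F : E × F →L[𝕜] E × F)

@[simp]
lemma isInvertible_linearAdjoint_iff {D : E × F →L[𝕜] G × G'} :
    (linearAdjoint D).IsInvertible ↔ D.IsInvertible := by
  simp [linearAdjoint]

lemma inverse_linearAdjoint (D : E × F →L[𝕜] G × G') :
    (linearAdjoint D).inverse =
      (negSnd 𝕜 E F : E × F →L[𝕜] E × F) ∘L D.inverse ∘L
        (ContinuousLinearEquiv.prodComm 𝕜 G' G : G' × G →L[𝕜] G × G') := by
  rw [linearAdjoint, ContinuousLinearMap.inverse_equiv_comp,
    ContinuousLinearMap.inverse_comp_equiv, negSnd_symm]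
  rfl

lemma coprod_comp_inverse_linearAdjoint (D : E × F →L[𝕜] G × G') (a : E →L[𝕜] W)
    (b : F →L[𝕜] W) :
    a.coprod b ∘L (linearAdjoint D).inverse =
      -((-a).coprod b ∘L D.inverse ∘L
        (ContinuousLinearEquiv.prodComm 𝕜 G' G : G' × G →L[𝕜] G × G')) := by
  ext u <;> simp [inverse_linearAdjoint, add_comm]

end LinearAlgebra

variable {E : Type*} [NormedAddCommGroup E] [NormedSpace ℝ E]
  {H : Type*} [TopologicalSpace H] {I : ModelWithCorners ℝ E H}
  {M : Type*} [TopologicalSpace M] [ChartedSpace H M]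

namespace PartialMap

variable {R S T : PartialMap I M}

lemma Same.symm (h : R.Same S) : S.Same R :=
  ⟨h.1.symm, h.1 ▸ h.2.symm⟩

lemma Same.trans (h : R.Same S) (h' : S.Same T) : R.Same T :=
  ⟨h.1.trans h'.1, h.2.trans (h.1 ▸ h'.2)⟩

lemma mem_adjoint_dom_iff {w : TangentBundle I M} : w ∈ R.adjoint.dom ↔ fiberNeg w ∈ R.dom :=
  Iff.rfl

lemma adjoint_apply (w : TangentBundle I M) :
    R.adjoint.toFun w = (R.toFun (fiberNeg w)).swap := rfl

end PartialMap

section TangentCoordinates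

variable [IsManifold I 1 M]

lemma snd_trivializationAt_fiberNeg {x : M} {w : TangentBundle I M}
    (hw : w.proj ∈ (chartAt H x).source) :
    (trivializationAt E (TangentSpace I) x (fiberNeg w)).2 =
      -(trivializationAt E (TangentSpace I) x w).2 :=
  ((trivializationAt E (TangentSpace I) x).linear ℝ
    (by rwa [TangentBundle.trivializationAt_baseSet])).map_neg w.snd

lemma continuous_fiberNeg : Continuous (fiberNeg : TangentBundle I M → TangentBundle I M) := by
  refine continuous_iff_continuousAt.2 fun w => ?_
  obtain ⟨hproj, hsnd⟩ := (FiberBundle.continuousAt_totalSpace E _).1 (continuousAt_id (x := w))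
  have hsource : ∀ᶠ z : TangentBundle I M in 𝓝 w, z.proj ∈ (chartAt H w.proj).source :=
    hproj.eventually (chart_source_mem_nhds H w.proj)
  refine (FiberBundle.continuousAt_totalSpace E _).2 ⟨hproj, hsnd.neg.congr ?_⟩
  filter_upwards [hsource] with z hz using (snd_trivializationAt_fiberNeg hz).symm

lemma extChartAt_fiberNeg {w z : TangentBundle I M}
    (hz : z.proj ∈ (chartAt H w.proj).source) :
    extChartAt I.tangent w (fiberNeg z) = negSnd ℝ E E (extChartAt I.tangent w z) := by
  rw [FiberBundle.extChartAt]
  exact Prod.ext rfl (snd_trivializationAt_fiberNeg hz)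

lemma writtenInExtChartAt_fiberNeg {w : TangentBundle I M} {u : E × E}
    (hu : u ∈ (extChartAt I.tangent w).target) :
    writtenInExtChartAt I.tangent I.tangent w fiberNeg u = negSnd ℝ E E u := by
  have hsource := (extChartAt I.tangent w).map_target hu
  rw [extChartAt_source, TangentBundle.mem_chart_source_iff] at hsource
  have h := extChartAt_fiberNeg hsource
  rwa [(extChartAt I.tangent w).right_inv hu] at h

lemma hasMFDerivAt_fiberNeg (w : TangentBundle I M) :
    HasMFDerivAt I.tangent I.tangent fiberNeg w (negSnd ℝ E E : E × E →L[ℝ] E × E) :=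
  ⟨continuous_fiberNeg.continuousAt, (negSnd ℝ E E).hasFDerivWithinAt.congr_of_eventuallyEq
    (Filter.eventuallyEq_of_mem (extChartAt_target_mem_nhdsWithin w)
      fun _ => writtenInExtChartAt_fiberNeg)
    (writtenInExtChartAt_fiberNeg (mem_extChartAt_target w))⟩

lemma PartialMap.hasMFDerivAt_adjoint {R : PartialMap I M} {w : TangentBundle I M}
    {D : E × E →L[ℝ] E × E} (hD : HasMFDerivAt I.tangent (I.prod I) R.toFun (fiberNeg w) D) :
    HasMFDerivAt I.tangent (I.prod I) R.adjoint.toFun w (linearAdjoint D) :=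
  ((hasMFDerivAt_snd _).prodMk (hasMFDerivAt_fst _)).comp w (hD.comp w (hasMFDerivAt_fiberNeg w))

/-- The tangent vector of `T^*M` with coordinates `(q, p, q̇, ṗ) = (q, p, v, f)` in the charts
induced by the preferred chart of `M` at `q`. -/
def ofCoords (q : M) (p : E →L[ℝ] ℝ) (v : E) (f : E →L[ℝ] ℝ) :
    TangentBundle (cotangentModel I) (CotangentBundle I M) :=
  ⟨⟨q, p⟩, (v, f)⟩

lemma exists_ofCoords_eq (V : TangentBundle (cotangentModel I) (CotangentBundle I M)) :
    ∃ q p v f, ofCoords q p v f = V :=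
  ⟨_, _, _, _, rfl⟩

lemma fiberNeg_ofCoords (q : M) (p : E →L[ℝ] ℝ) (v : E) (f : E →L[ℝ] ℝ) :
    fiberNeg (ofCoords q p v f : TangentBundle (cotangentModel I) (CotangentBundle I M)) =
      ofCoords q p (-v) (-f) := rfl

end TangentCoordinates

namespace PartialMap

variable [IsManifold I ∞ M] {R S : PartialMap I M} {q : M} {v : E} {p f : E →L[ℝ] ℝ}
  {D : E × E →L[ℝ] E × E}

lemma ofCoords_mem_cotangentLift_dom_iff
    (hD : mfderiv I.tangent (I.prod I) R.toFun ⟨q, v⟩ = D) :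
    ofCoords q p v f ∈ R.cotangentLift.dom ↔
      (⟨q, v⟩ : TangentBundle I M) ∈ R.dom ∧ D.IsInvertible := by
  subst hD
  rfl

lemma cotangentLift_ofCoords (hD : mfderiv I.tangent (I.prod I) R.toFun ⟨q, v⟩ = D) :
    R.cotangentLift.toFun (ofCoords q p v f) =
      (⟨(R.toFun ⟨q, v⟩).1, -((f.coprod p ∘L D.inverse) ∘L ContinuousLinearMap.inl ℝ E E)⟩,
        ⟨(R.toFun ⟨q, v⟩).2, (f.coprod p ∘L D.inverse) ∘L ContinuousLinearMap.inr ℝ E E⟩) := by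
  subst hD
  rfl

theorem cotangentLift_adjoint_same
    (hR : ∀ w ∈ R.dom, MDifferentiableAt I.tangent (I.prod I) R.toFun w) :
    R.adjoint.cotangentLift.Same R.cotangentLift.adjoint := by
  have hmfderiv {q : M} {v : E} (hv : (⟨q, v⟩ : TangentBundle I M) ∈ R.adjoint.dom) :
      ∃ D : E × E →L[ℝ] E × E, mfderiv I.tangent (I.prod I) R.toFun ⟨q, -v⟩ = D ∧
        mfderiv I.tangent (I.prod I) R.adjoint.toFun ⟨q, v⟩ = linearAdjoint D :=
    ⟨_, rfl, (hasMFDerivAt_adjoint (hR _ hv).hasMFDerivAt).mfderiv⟩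
  refine ⟨Set.ext fun V => ?_, fun V hV => ?_⟩ <;>
    obtain ⟨q, p, v, f, rfl⟩ := exists_ofCoords_eq V
  · rw [mem_adjoint_dom_iff, fiberNeg_ofCoords, ofCoords_mem_cotangentLift_dom_iff rfl,
      ofCoords_mem_cotangentLift_dom_iff rfl]
    refine and_congr_right fun hv => ?_
    obtain ⟨D, hD, hD_adjoint⟩ := hmfderiv hv
    rw [hD, hD_adjoint]
    exact isInvertible_linearAdjoint_iff
  · obtain ⟨D, hD, hD_adjoint⟩ := hmfderiv (q := q) (v := v) hV.1
    rw [adjoint_apply, fiberNeg_ofCoords, cotangentLift_ofCoords hD_adjoint,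
      cotangentLift_ofCoords hD, coprod_comp_inverse_linearAdjoint,
      ContinuousLinearMap.neg_comp, neg_neg]
    rfl

lemma Same.cotangentLift (h : R.Same S) (hR : IsOpen R.dom) :
    R.cotangentLift.Same S.cotangentLift := by
  have hmfderiv {q : M} {v : E} (hv : (⟨q, v⟩ : TangentBundle I M) ∈ R.dom) :
      mfderiv I.tangent (I.prod I) R.toFun ⟨q, v⟩ =
        mfderiv I.tangent (I.prod I) S.toFun ⟨q, v⟩ :=
    (h.2.eventuallyEq_of_mem (hR.mem_nhds hv)).mfderiv_eq
  refine ⟨Set.ext fun V => ?_, fun V hV => ?_⟩ <;>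
    obtain ⟨q, p, v, f, rfl⟩ := exists_ofCoords_eq V
  · rw [ofCoords_mem_cotangentLift_dom_iff rfl, ofCoords_mem_cotangentLift_dom_iff rfl, ← h.1]
    exact and_congr_right fun hv => by rw [hmfderiv hv]
  · have hv : (⟨q, v⟩ : TangentBundle I M) ∈ R.dom := hV.1
    rw [cotangentLift_ofCoords (hmfderiv hv), cotangentLift_ofCoords rfl, h.2 hv]

end PartialMap

end DiscretizationMaps

theorem mainTheorem8_general {E : Type*} [NormedAddCommGroup E] [NormedSpace ℝ E]
    {H : Type*} [TopologicalSpace H] (I : ModelWithCorners ℝ E H)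
    (Q : Type*) [TopologicalSpace Q] [ChartedSpace H Q] [IsManifold I ∞ Q]
    (R : DiscretizationMaps.PartialMap I Q) (hopen : IsOpen R.dom)
    (hdiff : ∀ w ∈ R.dom, MDifferentiableAt I.tangent (I.prod I) R.toFun w) :
    R.adjoint.cotangentLift.Same R.cotangentLift.adjoint ∧
      (R.IsSymmetric → R.cotangentLift.IsSymmetric) := by
  have hadjoint := DiscretizationMaps.PartialMap.cotangentLift_adjoint_same hdiff
  exact ⟨hadjoint, fun hsymm => hadjoint.symm.trans (hsymm.symm.cotangentLift hopen).symm⟩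

theorem mainTheorem8 {E : Type*} [NormedAddCommGroup E] [NormedSpace ℝ E] [FiniteDimensional ℝ E]
    {H : Type*} [TopologicalSpace H] (I : ModelWithCorners ℝ E H) [I.Boundaryless]
    (Q : Type*) [TopologicalSpace Q] [ChartedSpace H Q] [IsManifold I ∞ Q]
    (R : DiscretizationMaps.PartialMap I Q) (hR : R.IsDiscretizationMap) :
    R.adjoint.cotangentLift.Same R.cotangentLift.adjoint ∧
      (R.IsSymmetric → R.cotangentLift.IsSymmetric) :=
  mainTheorem8_general I Q R hR.isOpen_dom fun _ hw =>
    (hR.smooth.contMDiffAt (hR.isOpen_dom.mem_nhds hw)).mdifferentiableAt (by simp)
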